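/- \textbf{Setting.} Let $\mathcal H,\mathcal V$ be real Hilbert spaces, $\mathcal V$ densely and continuously embedded in $\mathcal H$; identify $\mathcal H$ with its dual, so that $\mathcal V\hookrightarrow\mathcal H=\mathcal H'\hookrightarrow\mathcal V'$. Let $U=\prod_{j=1}^J U_j$, where $U_j$ is a closed subspace of $L^2(X_j,\mu_j)^{N_j}$, $X_j$ is a metric space and $\mu_j$ is a finite measure on a $\sigma$-algebra containing the Borel sets of $X_j$. Let $I_U:\mathcal V\to U$ be the canonical bounded linear map, also viewed as the operator $\mathcal V\to\mathcal V'$, $\langle I_Uu,v\rangle=(I_Uu,I_Uv)_U$. Let $\alpha_j\in C([0,\infty)\times X_j;(0,\infty))$ be such that for each $T>0$ there is $\kappa(T)>0$ with $|\alpha_j(t,x)-\alpha_j(s,x)|\le\kappa(T)|t-s|$ for all $s,t\in[0,T]$, $x\in X_j$. Let $g_j:\mathbb R^{N_j}\to\mathbb R^{N_j}$ be continuous with $(g_j(x)-g_j(y))\cdot(x-y)\ge 0$, $g_j(0)=0$ and $|g_j(x)|\le M(1+|x|)$ for some $M>0$. Define $B(t)u\in\mathcal V'$ by $$\langle B(t)u,v\rangle=\sum_{j=1}^J\int_{X_j}\alpha_j(t,x_j)\,g_j((I_Uu)_j(x_j))\cdot(I_Uv)_j(x_j)\,d\mu_j(x_j),\qquad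 v\in\mathcal V$$ (whenever these integrals converge for all $v\in\mathcal V$ and define an element of $\mathcal V'$). Let $A_1:\mathcal V\to\mathcal V'$ be bounded and linear with $\langle A_1u,u\rangle=0$ for all $u\in\mathcal V$, and let $\mathcal A_B(t)=A_1+B(t)$ with domain $D(\mathcal A_B(t))=\{v\in\mathcal V: (A_1+B(t))v\in\mathcal H\}$. A solution of $$x'(t)+A_1x(t)+B(t)x(t)=0\ \text{ in }\mathcal H,\ t\ge0,\qquad x(0)=x_0,$$ means a function $x\in C([0,\infty),\mathcal H)$ with $x(0)=x_0$, $x(t)\in D(\mathcal A_B(t))$ for all $t\ge0$, such that outside a countable set of times $x'(t)=-\mathcal A_B(t)x(t)$ exists in $\mathcal H$ and is continuous. Its energy is $\mathcal E(t)=\frac12\|x(t)\|_{\mathcal H}^2$. \textbf{Statement.} Let $C,\omega>0$. There is $T_0>0$ such that for every $T\ge T_0$ there is a constant $D>1$, depending only on $T$, $C$ and $\omega$, with the following property. In any setting as above, suppose that $A_1-I_U$ (with domain $\{v\in\mathcal V:(A_1-I_U)v\in\mathcal H\}$) generates a $C_0$-semigroup of contractions in $\mathcal H$, and that $-A_1-I_U$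 (with the analogous domain) generates a $C_0$-semigroup of contractions $(S(t))_{t\ge0}$ in $\mathcal H$ such that $\|S(t)x_0\|_{\mathcal H}\le Ce^{-\omega t}\|x_0\|_{\mathcal H}$ for all $t\ge0$ and $x_0\in\mathcal H$. Then every solution $x$ satisfies $$\mathcal E(T)\le D\sum_{j=1}^J\int_0^T\int_{X_j}\Big(|(I_Ux(t))_j|^2+\alpha_j(t,\cdot)^2\,|g_j((I_Ux(t))_j)|^2\Big)\,d\mu_j\,dt$$ and, for every $n\in\mathbb N$ (including $n=0$), $$\mathcal E((n+1)T)\le D\sum_{j=1}^J\int_{nT}^{(n+1)T}\int_{X_j}\Big(|(I_Ux(t))_j|^2+\alpha_j(t,\cdot)^2\,|g_j((I_Ux(t))_j)|^2\Big)\,d\mu_j\,dt,$$ where the integrals of nonnegative functions take values in $[0,\infty]$. -/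

import Mathlib

open Set Filter Topology MeasureTheory
open scoped ENNReal RealInnerProductSpace

noncomputable section

/-- A strongly continuous semigroup of bounded linear operators `S t`, `t ≥ 0`, on a real Banach
space.  Only the values at `t ≥ 0` are meaningful. -/
structure C0Semigroup (H : Type*) [NormedAddCommGroup H] [NormedSpace ℝ H] where
  /-- the operators of the semigroup -/
  toFun : ℝ → H →L[ℝ] H
  map_zero : toFun 0 = ContinuousLinearMap.id ℝ H
  map_add : ∀ s t : ℝ, 0 ≤ s → 0 ≤ t → toFun (s + t) = (toFun s).comp (toFun t)
  continuousOn : ∀ x : H, ContinuousOn (fun t => toFun t x) (Ici 0)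

/-- The semigroup consists of contractions. -/
def C0Semigroup.IsContractive {H : Type*} [NormedAddCommGroup H] [NormedSpace ℝ H]
    (S : C0Semigroup H) : Prop :=
  ∀ t : ℝ, 0 ≤ t → ∀ x : H, ‖S.toFun t x‖ ≤ ‖x‖

/-- `x` belongs to the domain of the infinitesimal generator of `S`, and the generator maps `x`
to `y`. -/
def C0Semigroup.GeneratorMaps {H : Type*} [NormedAddCommGroup H] [NormedSpace ℝ H]
    (S : C0Semigroup H) (x y : H) : Prop :=
  Tendsto (fun t : ℝ => t⁻¹ • (S.toFun t x - x)) (𝓝[>] 0) (𝓝 y)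

section Triple

variable {H V : Type*} [NormedAddCommGroup H] [InnerProductSpace ℝ H]
  [NormedAddCommGroup V] [InnerProductSpace ℝ V]

/-- In the Gelfand triple `V ↪ H = H' ↪ V'` with embedding `ι : V → H`, the functional `φ ∈ V'`
belongs to `H` and is identified with `h ∈ H`: `⟨φ, v⟩ = (h, v)_H` for all `v ∈ V`. -/
def BelongsToPivot (ι : V →L[ℝ] H) (φ : StrongDual ℝ V) (h : H) : Prop :=
  ∀ v : V, φ v = ⟪h, ι v⟫

/-- The operator `L : V → V'`, restricted to the domain `{v ∈ V | L v ∈ H}` and seen as an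
unbounded operator of `H`, is the infinitesimal generator of the semigroup `S`
(same domain and same values). -/
def Generates (ι : V →L[ℝ] H) (L : V →L[ℝ] StrongDual ℝ V) (S : C0Semigroup H) : Prop :=
  ∀ x y : H, S.GeneratorMaps x y ↔ ∃ v : V, ι v = x ∧ BelongsToPivot ι (L v) y

end Triple

/-- The data of the abstract evolution equation `x' + A₁ x + B(t) x = 0`:
the dense continuous embedding `V ↪ H`, the control space `U = ∏ U_j` with `U_j` a closed subspace
of `L²(X_j, μ_j)^{N_j}`, the bounded operators `I_U : V → U` and `A₁ : V → V'`, the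
time-dependent coefficients `α_j`, and the nonlinearities `g_j`. -/
structure DampedSystem (H V : Type*) [NormedAddCommGroup H] [InnerProductSpace ℝ H]
    [NormedAddCommGroup V] [InnerProductSpace ℝ V] {J : ℕ} (N : Fin J → ℕ)
    (X : Fin J → Type*) [∀ j, MetricSpace (X j)] [∀ j, MeasurableSpace (X j)]
    (μ : ∀ j, Measure (X j)) where
  /-- the embedding of `V` into `H` -/
  ι : V →L[ℝ] H
  ι_injective : Function.Injective ι
  ι_denseRange : DenseRange ι
  /-- the factors of the control space -/
  U : ∀ j, Submodule ℝ (Lp (EuclideanSpace ℝ (Fin (N j))) 2 (μ j))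
  U_closed : ∀ j, IsClosed (U j : Set (Lp (EuclideanSpace ℝ (Fin (N j))) 2 (μ j)))
  /-- the canonical continuous linear map of `V` into the control space (the product carries its
  Hilbert structure) -/
  IU : V →L[ℝ] PiLp 2 (fun j => U j)
  /-- the coefficients `α_j(t, x)`, for `t ≥ 0` -/
  α : ∀ j, ℝ → X j → ℝ
  α_continuousOn : ∀ j, ContinuousOn (fun p : ℝ × X j => α j p.1 p.2) (Ici 0 ×ˢ univ)
  α_pos : ∀ j, ∀ t : ℝ, 0 ≤ t → ∀ x : X j, 0 < α j t x
  α_lipschitz : ∀ j, ∀ T : ℝ, 0 < T → ∃ κ : ℝ, 0 < κ ∧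
    ∀ s ∈ Icc (0 : ℝ) T, ∀ t ∈ Icc (0 : ℝ) T, ∀ x : X j, |α j t x - α j s x| ≤ κ * |t - s|
  /-- the nonlinearities `g_j` -/
  g : ∀ j, EuclideanSpace ℝ (Fin (N j)) → EuclideanSpace ℝ (Fin (N j))
  g_continuous : ∀ j, Continuous (g j)
  g_monotone : ∀ j, ∀ x y, 0 ≤ ⟪g j x - g j y, x - y⟫
  g_zero : ∀ j, g j 0 = 0
  g_growth : ∃ M : ℝ, 0 < M ∧ ∀ j, ∀ x, ‖g j x‖ ≤ M * (1 + ‖x‖)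
  /-- the bounded linear operator `A₁ : V → V'` -/
  A₁ : V →L[ℝ] StrongDual ℝ V

namespace DampedSystem

variable {H V : Type*} [NormedAddCommGroup H] [InnerProductSpace ℝ H]
  [NormedAddCommGroup V] [InnerProductSpace ℝ V] {J : ℕ} {N : Fin J → ℕ}
  {X : Fin J → Type*} [∀ j, MetricSpace (X j)] [∀ j, MeasurableSpace (X j)]
  {μ : ∀ j, Measure (X j)} (P : DampedSystem H V N X μ)

/-- The `j`-th component `(I_U u)_j` of `I_U u`, as a function on `X_j`
(defined up to a `μ_j`-null set). -/
def comp (u : V) (j : Fin J) : X j → EuclideanSpace ℝ (Fin (N j)) :=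
  ((P.IU u j : P.U j) : Lp (EuclideanSpace ℝ (Fin (N j))) 2 (μ j))

/-- The operator `I_U`, seen as an operator of `V` into `V'`:
`⟨I_U u, v⟩ = (I_U u, I_U v)_U`. -/
def IUdual : V →L[ℝ] StrongDual ℝ V :=
  (innerSL ℝ (E := PiLp 2 (fun j => P.U j))).bilinearComp P.IU P.IU

/-- `b = B(t) u` in `V'`, that is,
`⟨b, v⟩ = ∑ j, ∫ α_j(t, x) g_j((I_U u)_j(x)) · (I_U v)_j(x) dμ_j(x)` for all `v ∈ V`,
with convergent integrals. -/
def IsFeedback (t : ℝ) (u : V) (b : StrongDual ℝ V) : Prop :=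
  ∀ v : V,
    (∀ j, Integrable (fun x => P.α j t x * ⟪P.g j (P.comp u j x), P.comp v j x⟫) (μ j)) ∧
    b v = ∑ j, ∫ x, P.α j t x * ⟪P.g j (P.comp u j x), P.comp v j x⟫ ∂(μ j)

/-- `u` belongs to the domain `{u ∈ V | (A₁ + B(t)) u ∈ H}` of the operator `𝒜_B(t)`, and
`𝒜_B(t) u = h`. -/
def OperatorMaps (t : ℝ) (u : V) (h : H) : Prop :=
  ∃ b : StrongDual ℝ V, P.IsFeedback t u b ∧ BelongsToPivot P.ι (P.A₁ u + b) h

/-- `x` is a solution of `x' + A₁ x + B(t) x = 0`, `x(0) = x₀`: it is continuous on `[0, ∞)` with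
values in `H`, `x(t)` belongs to the domain of `𝒜_B(t)` for every `t ≥ 0`, and outside a countable
set of times the strong derivative `x'(t) = -𝒜_B(t) x(t)` exists in `H` and is continuous.
As `x(t) ∈ V` for all `t ≥ 0`, solutions are written as functions with values in `V`; their values
at negative times are irrelevant. -/
structure IsSolution (x₀ : H) (x : ℝ → V) : Prop where
  continuousOn : ContinuousOn (fun t => P.ι (x t)) (Ici 0)
  mem_domain : ∀ t : ℝ, 0 ≤ t → ∃ h : H, P.OperatorMaps t (x t) h
  equation : ∃ Z : Set ℝ, Z.Countable ∧ ∃ x' : ℝ → H, ContinuousOn x' (Ici 0 \ Z) ∧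
    ∀ t ∈ Ici (0 : ℝ) \ Z,
      HasDerivWithinAt (fun s => P.ι (x s)) (x' t) (Ici 0) t ∧ P.OperatorMaps t (x t) (-x' t)
  initial : P.ι (x 0) = x₀

/-- The energy `½ ‖x(t)‖²_H`. -/
def energy (x : ℝ → V) (t : ℝ) : ℝ := 1 / 2 * ‖P.ι (x t)‖ ^ 2

/-- The quantity
`∑ j, ∫_a^b ∫_{X_j} (|(I_U x(t))_j|² + α_j(t, ·)² |g_j((I_U x(t))_j)|²) dμ_j dt ∈ [0, ∞]`. -/
def observation (x : ℝ → V) (a b : ℝ) : ℝ≥0∞ :=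
  ∑ j, ∫⁻ t in Ioc a b, ∫⁻ y, ENNReal.ofReal
    (‖P.comp (x t) j y‖ ^ 2 + P.α j t y ^ 2 * ‖P.g j (P.comp (x t) j y)‖ ^ 2) ∂(μ j)

end DampedSystem

end

/-! The proof is a duality argument. Since `A₁` is antisymmetric and `I_U` symmetric, the generators
of `S` (from `-A₁ - I_U`) and `R` (from `A₁ - I_U`) are formally adjoint. Hence `R(T)` is the
adjoint of `S(T)` and inherits its norm bound, which is at most `1/2` for large `T`.

Test a solution `x` on `[a, b]`, `b = a + T`, against the backward orbit `r(t) = R(b - t) z`. In the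
derivative of `⟪x, r⟫` the `A₁` terms cancel, leaving `⟨I_U x, r⟩ - ⟨B(t) x, r⟩`. By Young's
inequality this is at most the observed density plus `½ ⟨I_U r, r⟩`. The last term integrates to at
most `¼ ‖z‖²`, because `⟨I_U r, r⟩` is exactly the dissipation of `r`. Taking `z = x(b)` gives, with
`O` the observation, `‖x(b)‖² - ⟪x(a), R(T) x(b)⟫ ≤ O + ¼ ‖x(b)‖²`. The energy identity gives
`‖x(a)‖² ≤ ‖x(b)‖² + O`, and smallness of `R(T)` absorbs the cross term.

The technical point is that `x` is continuous only in `H`, while the observation sees it in `V`.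
Measurability in `V` comes from a Tikhonov regularization of the inverse of `ι`. -/

/-! ### Orbits, generators and adjoint pairs of semigroups -/

namespace C0Semigroup

variable {H : Type*} [NormedAddCommGroup H] [InnerProductSpace ℝ H]

/-- Truncating at `max t 0` discards the meaningless values at negative times, so that orbits are
continuous on the whole line. -/
theorem continuous_orbit (S : C0Semigroup H) (x : H) :
    Continuous (fun t : ℝ => S.toFun (max t 0) x) :=
  (S.continuousOn x).comp_continuous (by fun_prop) (fun t => le_max_right t 0)

theorem GeneratorMaps.apply {S : C0Semigroup H} {x y : H} (h : S.GeneratorMaps x y)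
    {t : ℝ} (ht : 0 ≤ t) : S.GeneratorMaps (S.toFun t x) (S.toFun t y) := by
  have h1 : Tendsto (fun s : ℝ => S.toFun t (s⁻¹ • (S.toFun s x - x))) (𝓝[>] 0)
      (𝓝 (S.toFun t y)) := ((S.toFun t).continuous.tendsto y).comp h
  refine h1.congr' ?_
  filter_upwards [self_mem_nhdsWithin] with s hs
  have hs' : (0 : ℝ) ≤ s := le_of_lt hs
  have e1 : S.toFun s (S.toFun t x) = S.toFun t (S.toFun s x) := by
    have h1 := congrArg (fun f => f x) (S.map_add s t hs' ht)
    have h2 := congrArg (fun f => f x) (S.map_add t s ht hs')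
    simp only [ContinuousLinearMap.comp_apply] at h1 h2
    rw [← h1, ← h2, add_comm]
  rw [map_smul, map_sub, e1]

theorem GeneratorMaps.hasDerivWithinAt {S : C0Semigroup H} {x y : H} (h : S.GeneratorMaps x y)
    {t : ℝ} (ht : 0 ≤ t) :
    HasDerivWithinAt (fun s => S.toFun (max s 0) x) (S.toFun t y) (Ioi t) t := by
  rw [hasDerivWithinAt_iff_tendsto_slope' (by simp)]
  have h1 : Tendsto (fun s : ℝ => s - t) (𝓝[>] t) (𝓝[>] 0) := by
    refine tendsto_nhdsWithin_iff.2 ⟨?_, ?_⟩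
    · have : Tendsto (fun s : ℝ => s - t) (𝓝 t) (𝓝 (t - t)) := by
        exact Continuous.tendsto (by fun_prop) t
      rw [sub_self] at this
      exact this.mono_left nhdsWithin_le_nhds
    · filter_upwards [self_mem_nhdsWithin] with s hs
      exact mem_Ioi.2 (sub_pos.2 (mem_Ioi.1 hs))
  refine ((h.apply ht).comp h1).congr' ?_
  filter_upwards [self_mem_nhdsWithin] with s hs
  have hs' : t < s := hs
  have e := congrArg (fun f => f x) (S.map_add (s - t) t (by linarith) ht)
  simp only [ContinuousLinearMap.comp_apply, sub_add_cancel] at e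
  simp only [Function.comp_apply, slope, vsub_eq_sub]
  rw [max_eq_left ht, max_eq_left (ht.trans hs'.le), e]

variable [CompleteSpace H]

/-- The generator only provides a right derivative. As `t ↦ S(t) y` is continuous, the orbit of `x`
is its primitive up to a constant, which makes the derivative two-sided. -/
theorem GeneratorMaps.hasDerivAt {S : C0Semigroup H} {x y : H} (h : S.GeneratorMaps x y)
    {t : ℝ} (ht : 0 < t) :
    HasDerivAt (fun s => S.toFun (max s 0) x) (S.toFun t y) t := by
  have key : ∀ s, 0 ≤ s → ∫ r in (0 : ℝ)..s, S.toFun (max r 0) y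
      = S.toFun (max s 0) x - S.toFun (max 0 0) x := by
    intro s hs
    refine intervalIntegral.integral_eq_sub_of_hasDeriv_right (S.continuous_orbit x).continuousOn
      (fun r hr => ?_) ((S.continuous_orbit y).intervalIntegrable _ _)
    rw [min_eq_left hs] at hr
    have := h.hasDerivWithinAt hr.1.le
    rwa [max_eq_left hr.1.le]
  have hd := intervalIntegral.integral_hasDerivAt_right
    ((S.continuous_orbit y).intervalIntegrable 0 t)
    ((S.continuous_orbit y).stronglyMeasurableAtFilter _ _) (S.continuous_orbit y).continuousAt
  have hd' := hd.add_const (S.toFun (max 0 0) x)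
  rw [max_eq_left ht.le] at hd'
  refine hd'.congr_of_eventuallyEq ?_
  filter_upwards [lt_mem_nhds ht] with s hs
  rw [key s hs.le]; simp

/-- The domain of the infinitesimal generator is dense. -/
theorem dense_domain (S : C0Semigroup H) : Dense {x : H | ∃ y, S.GeneratorMaps x y} := by
  intro x
  have hc := S.continuous_orbit x
  have hint : ∀ a b : ℝ, IntervalIntegrable (fun s => S.toFun (max s 0) x) volume a b :=
    fun a b => hc.intervalIntegrable a b
  have hderiv : ∀ t : ℝ, HasDerivAt (fun s => ∫ r in (0 : ℝ)..s, S.toFun (max r 0) x)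
      (S.toFun (max t 0) x) t := fun t =>
    intervalIntegral.integral_hasDerivAt_right (hint 0 t)
      (hc.stronglyMeasurableAtFilter _ _) hc.continuousAt
  set I : ℝ → H := fun s => ∫ r in (0 : ℝ)..s, S.toFun (max r 0) x with hI
  have hI0 : I 0 = 0 := by simp [hI]
  -- The averages `t⁻¹ ∫₀ᵗ S(r) x dr` lie in the domain and converge to `x` as `t → 0+`.
  refine mem_closure_of_tendsto (f := fun t : ℝ => t⁻¹ • I t) (b := 𝓝[>] (0 : ℝ)) ?_ ?_
  · have := (hasDerivWithinAt_iff_tendsto_slope' (s := Ioi (0 : ℝ)) (by simp)).1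
      (hderiv 0).hasDerivWithinAt
    rw [max_self, S.map_zero] at this
    refine this.congr (fun t => ?_)
    simp only [slope, vsub_eq_sub, sub_zero, hI0]
  · filter_upwards [self_mem_nhdsWithin] with t ht
    have ht' : (0 : ℝ) < t := ht
    refine ⟨t⁻¹ • (S.toFun (max t 0) x - S.toFun (max 0 0) x), ?_⟩
    have hd : HasDerivAt (fun s => t⁻¹ • (I (t + s) - I s))
        (t⁻¹ • (S.toFun (max t 0) x - S.toFun (max 0 0) x)) 0 := by
      have h1 : HasDerivAt (fun s => I (t + s)) (S.toFun (max t 0) x) 0 := by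
        have := hderiv (t + 0)
        have h2 := this.comp_const_add t 0
        simpa using h2
      exact (h1.sub (hderiv 0)).const_smul t⁻¹
    have := (hasDerivWithinAt_iff_tendsto_slope' (s := Ioi (0 : ℝ)) (by simp)).1
      hd.hasDerivWithinAt
    refine this.congr' ?_
    filter_upwards [self_mem_nhdsWithin] with h hh
    have hh' : (0 : ℝ) < h := hh
    simp only [slope, vsub_eq_sub, sub_zero, hI0, add_zero]
    congr 1
    rw [map_smul, ← smul_sub, ← smul_sub]
    congr 1
    have e1 : S.toFun h (I t) = I (t + h) - I h := by
      have e2 : S.toFun h (I t) = ∫ r in (0 : ℝ)..t, S.toFun h (S.toFun (max r 0) x) :=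
        ((S.toFun h).intervalIntegral_comp_comm (hint 0 t)).symm
      have e3 : ∫ r in (0 : ℝ)..t, S.toFun h (S.toFun (max r 0) x)
          = ∫ r in (0 : ℝ)..t, S.toFun (max (r + h) 0) x := by
        refine intervalIntegral.integral_congr (fun r hr => ?_)
        rw [uIcc_of_le ht'.le] at hr
        have e := congrArg (fun f => f x) (S.map_add h r hh'.le hr.1)
        simp only [ContinuousLinearMap.comp_apply] at e
        rw [max_eq_left hr.1, max_eq_left (by linarith [hr.1]), ← e, add_comm]
      rw [e2, e3, intervalIntegral.integral_comp_add_right (fun r => S.toFun (max r 0) x) h,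
        zero_add, ← intervalIntegral.integral_interval_sub_left (hint 0 (t + h)) (hint 0 h)]
    rw [e1]

/-- Two semigroups whose generators are formally adjoint to each other are adjoint. -/
theorem inner_apply_eq_of_generators {S R : C0Semigroup H}
    (hSR : ∀ y y' z z' : H, S.GeneratorMaps y y' → R.GeneratorMaps z z' → ⟪y', z⟫ = ⟪y, z'⟫)
    {T : ℝ} (hT : 0 < T) (y z : H) : ⟪S.toFun T y, z⟫ = ⟪y, R.toFun T z⟫ := by
  have key : ∀ y ∈ {x : H | ∃ y, S.GeneratorMaps x y}, ∀ z ∈ {x : H | ∃ y, R.GeneratorMaps x y},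
      ⟪S.toFun T y, z⟫ = ⟪y, R.toFun T z⟫ := by
    rintro y ⟨y', hy⟩ z ⟨z', hz⟩
    -- Mean value theorem for `t ↦ ⟪S(t) y, R(T - t) z⟫`: its derivative vanishes by formal
    -- adjointness, so its values at `0` and `T` agree.
    obtain ⟨c, hc, hc'⟩ := exists_hasDerivAt_eq_slope
      (fun t => ⟪S.toFun (max t 0) y, R.toFun (max (T - t) 0) z⟫)
      (fun t => ⟪S.toFun (max t 0) y, -R.toFun (T - t) z'⟫
        + ⟪S.toFun t y', R.toFun (max (T - t) 0) z⟫) hT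
      (Continuous.continuousOn ((S.continuous_orbit y).inner
        ((R.continuous_orbit z).comp (by fun_prop : Continuous (fun t : ℝ => T - t)))))
      (fun t ht => (hy.hasDerivAt ht.1).inner ℝ
        ((hz.hasDerivAt (sub_pos.2 ht.2)).comp_const_sub T t))
    have h0 : ⟪S.toFun c y', R.toFun (T - c) z⟫ = ⟪S.toFun c y, R.toFun (T - c) z'⟫ :=
      hSR _ _ _ _ (hy.apply hc.1.le) (hz.apply (sub_nonneg.2 hc.2.le))
    rw [max_eq_left hc.1.le, max_eq_left (sub_nonneg.2 hc.2.le), inner_neg_right, h0,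
      neg_add_cancel, eq_comm, div_eq_zero_iff] at hc'
    rcases hc' with h | h
    · simpa [max_eq_left hT.le, S.map_zero, R.map_zero, sub_eq_zero] using h
    · linarith
  have h1 : ∀ z ∈ {x : H | ∃ y, R.GeneratorMaps x y}, ∀ y,
      ⟪S.toFun T y, z⟫ = ⟪y, R.toFun T z⟫ := fun z hz y =>
    isClosed_property (p := fun y => ⟪S.toFun T y, z⟫ = ⟪y, R.toFun T z⟫)
      S.dense_domain.denseRange_val
      (isClosed_eq (by fun_prop) (by fun_prop)) (fun y => key y.1 y.2 z hz) y
  exact isClosed_property (p := fun z => ⟪S.toFun T y, z⟫ = ⟪y, R.toFun T z⟫)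
    R.dense_domain.denseRange_val
      (isClosed_eq (by fun_prop) (by fun_prop)) (fun z => h1 z.1 z.2 y) z

/-- Adjoints have equal norms: `‖R(T) z‖² = ⟪S(T) R(T) z, z⟫`. This transfers the decay assumed for
`S` to `R`. -/
theorem norm_apply_le_of_generators {S R : C0Semigroup H}
    (hSR : ∀ y y' z z' : H, S.GeneratorMaps y y' → R.GeneratorMaps z z' → ⟪y', z⟫ = ⟪y, z'⟫)
    {T M : ℝ} (hT : 0 < T) (hS : ∀ y, ‖S.toFun T y‖ ≤ M * ‖y‖) (z : H) :
    ‖R.toFun T z‖ ≤ M * ‖z‖ := by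
  by_cases h0 : ‖R.toFun T z‖ = 0
  · have h1 := hS z
    rw [h0]
    exact (norm_nonneg _).trans h1
  · have h1 : ‖R.toFun T z‖ * ‖R.toFun T z‖ ≤ (M * ‖z‖) * ‖R.toFun T z‖ := by
      rw [← real_inner_self_eq_norm_mul_norm, ← inner_apply_eq_of_generators hSR hT]
      calc _ ≤ ‖S.toFun T (R.toFun T z)‖ * ‖z‖ := real_inner_le_norm _ _
        _ ≤ (M * ‖R.toFun T z‖) * ‖z‖ := by gcongr; exact hS _
        _ = _ := by ring
    exact le_of_mul_le_mul_right h1 (lt_of_le_of_ne (norm_nonneg _) (Ne.symm h0))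

end C0Semigroup

/-! ### Measurability of curves in `V` and semicontinuity of integrals -/

section Measurability

variable {H V : Type*} [NormedAddCommGroup H] [InnerProductSpace ℝ H] [CompleteSpace H]
  [NormedAddCommGroup V] [InnerProductSpace ℝ V] [CompleteSpace V]

/-- Tikhonov regularization: an injective bounded operator between Hilbert spaces has
approximate left inverses. -/
theorem exists_tendsto_leftInverse (ι : V →L[ℝ] H) (hι : Function.Injective ι) :
    ∃ L : ℕ → H →L[ℝ] V, ∀ v, Tendsto (fun n => L n (ι v)) atTop (𝓝 v) := by
  -- By Lax–Milgram for this form, `E n = 1 + n ι*ι` is invertible; the left inverses will be `n (E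
  -- n)⁻¹ ι*`, with error `(E n)⁻¹ v` at `v`.
  let a : ℕ → V →L[ℝ] V →L[ℝ] ℝ := fun n =>
    innerSL ℝ + (n : ℝ) • (innerSL ℝ (E := H)).bilinearComp ι ι
  have ha : ∀ n u w, a n u w = ⟪u, w⟫ + n * ⟪ι u, ι w⟫ := fun n u w => by simp [a]; rfl
  have hco : ∀ n, IsCoercive (a n) := fun n => ⟨1, one_pos, fun u => by
    rw [ha, real_inner_self_eq_norm_mul_norm, one_mul]
    have : 0 ≤ ⟪ι u, ι u⟫ := real_inner_self_nonneg
    nlinarith [mul_nonneg (Nat.cast_nonneg (α := ℝ) n) this]⟩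
  let E : ℕ → V ≃L[ℝ] V := fun n => (hco n).continuousLinearEquivOfBilin
  let ι' := ContinuousLinearMap.adjoint ι
  have hE : ∀ (n : ℕ) u, E n u = u + (n : ℝ) • ι' (ι u) := by
    intro n u
    refine ext_inner_right ℝ (fun w => ?_)
    rw [(hco n).continuousLinearEquivOfBilin_apply, ha, inner_add_left, inner_smul_left,
      ContinuousLinearMap.adjoint_inner_left]
    simp
  have hEs : ∀ (n : ℕ) u, ‖(E n).symm u‖ ≤ ‖u‖ := by
    intro n u
    set w := (E n).symm u with hw
    have hu : u = E n w := by simp [hw]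
    have h1 : ‖w‖ * ‖w‖ ≤ ‖u‖ * ‖w‖ := by
      refine le_trans ?_ (real_inner_le_norm u w)
      rw [hu, (hco n).continuousLinearEquivOfBilin_apply, ha, real_inner_self_eq_norm_mul_norm]
      have : 0 ≤ ⟪ι w, ι w⟫ := real_inner_self_nonneg
      nlinarith [mul_nonneg (Nat.cast_nonneg (α := ℝ) n) this]
    by_cases h0 : ‖w‖ = 0
    · rw [h0]; exact norm_nonneg _
    · exact le_of_mul_le_mul_right h1 (lt_of_le_of_ne (norm_nonneg _) (Ne.symm h0))
  refine ⟨fun n => (n : ℝ) • ((E n).symm : V →L[ℝ] V).comp ι', fun v => ?_⟩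
  have hdiff : ∀ n : ℕ, v - ((n : ℝ) • ((E n).symm : V →L[ℝ] V).comp ι') (ι v) = (E n).symm v := by
    intro n
    apply (E n).injective
    rw [map_sub, hE n v]
    simp
  -- A vector `w` orthogonal to the range satisfies `‖ι w‖² = 0`, so injectivity gives `w = 0`.
  have hdense : Dense (range fun w => ι' (ι w)) := by
    have : (ι'.comp ι).range.topologicalClosure = ⊤ := by
      rw [Submodule.topologicalClosure_eq_top_iff, Submodule.eq_bot_iff]
      intro w hw
      rw [Submodule.mem_orthogonal] at hw
      have := hw _ ⟨w, rfl⟩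
      simp only [ContinuousLinearMap.coe_coe, ContinuousLinearMap.comp_apply, ι',
        ContinuousLinearMap.adjoint_inner_left, inner_self_eq_zero] at this
      exact hι (by rw [this, map_zero])
    rw [← Submodule.dense_iff_topologicalClosure_eq_top] at this
    exact this
  -- On the dense range of `ι*ι` the inverses decay like `2‖w‖ / n`; elsewhere, approximate and use
  -- that they are contractions.
  have hlim : Tendsto (fun n => (E n).symm v) atTop (𝓝 0) := by
    rw [Metric.tendsto_atTop]
    intro ε hε
    obtain ⟨_, ⟨w, rfl⟩, hw⟩ := hdense.exists_dist_lt v (half_pos hε)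
    obtain ⟨m, hm⟩ := exists_nat_gt (2 * ‖w‖ / (ε / 2))
    have hm0 : (0 : ℝ) < m := lt_of_le_of_lt (by positivity) hm
    refine ⟨m, fun n hn => ?_⟩
    have hn' : (m : ℝ) ≤ n := by exact_mod_cast hn
    have hn0 : (0 : ℝ) < n := hm0.trans_le hn'
    have e : (n : ℝ) • (E n).symm (ι' (ι w)) = w - (E n).symm w := by
      apply (E n).injective
      rw [map_sub, hE n w]
      simp
    have h1 : (n : ℝ) * ‖(E n).symm (ι' (ι w))‖ ≤ 2 * ‖w‖ := by
      calc (n : ℝ) * ‖(E n).symm (ι' (ι w))‖ = ‖(n : ℝ) • (E n).symm (ι' (ι w))‖ := by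
            rw [norm_smul, Real.norm_of_nonneg hn0.le]
        _ ≤ ‖w‖ + ‖(E n).symm w‖ := by rw [e]; exact norm_sub_le _ _
        _ ≤ 2 * ‖w‖ := by linarith [hEs n w]
    have h2 : ‖(E n).symm (ι' (ι w))‖ < ε / 2 := by
      rw [div_lt_iff₀ (half_pos hε)] at hm
      have h3 : m * (ε / 2) ≤ n * (ε / 2) := by gcongr
      exact lt_of_mul_lt_mul_left (by linarith) hn0.le
    rw [dist_zero_right]
    calc ‖(E n).symm v‖ = ‖(E n).symm (v - ι' (ι w)) + (E n).symm (ι' (ι w))‖ := by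
          rw [← map_add]; simp
      _ ≤ ‖(E n).symm (v - ι' (ι w))‖ + ‖(E n).symm (ι' (ι w))‖ := norm_add_le _ _
      _ < ε / 2 + ε / 2 := by
          refine add_lt_add ((hEs n _).trans_lt ?_) h2
          rwa [← dist_eq_norm]
      _ = ε := by ring
  have h3 := (tendsto_const_nhds (x := v)).sub hlim
  rw [sub_zero] at h3
  refine h3.congr (fun n => ?_)
  rw [← hdiff n, sub_sub_cancel]

/-- A curve is strongly measurable if its image under an injective bounded operator is
continuous. -/
theorem stronglyMeasurable_of_continuous_comp (ι : V →L[ℝ] H) (hι : Function.Injective ι)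
    {f : ℝ → V} (hf : Continuous (fun t => ι (f t))) : StronglyMeasurable f := by
  obtain ⟨L, hL⟩ := exists_tendsto_leftInverse ι hι
  exact stronglyMeasurable_of_tendsto atTop
    (f := fun n t => L n (ι (f t)))
    (fun n => ((L n).continuous.comp hf).stronglyMeasurable)
    (tendsto_pi_nhds.2 fun t => hL (f t))

/-- Integrals of nonnegative continuous functions are lower semicontinuous on `L²`. -/
theorem lowerSemicontinuous_lintegral_comp {Y E : Type*} [MeasurableSpace Y] {ν : Measure Y}
    [IsFiniteMeasure ν] [NormedAddCommGroup E]
    {F : ℝ → Y → E → ℝ≥0∞} (hF : ∀ y, Continuous (fun p : ℝ × E => F p.1 y p.2))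
    (hFm : ∀ t (u : Lp E 2 ν), AEMeasurable (fun y => F t y (u y)) ν) :
    LowerSemicontinuous (fun p : ℝ × Lp E 2 ν => ∫⁻ y, F p.1 y (p.2 y) ∂ν) := by
  rw [lowerSemicontinuous_iff_isClosed_preimage]
  intro c
  refine IsSeqClosed.isClosed ?_
  intro p q hp hpq
  have h1 : Tendsto (fun n => (p n).1) atTop (𝓝 q.1) := (continuous_fst.tendsto q).comp hpq
  have h2 : Tendsto (fun n => (p n).2) atTop (𝓝 q.2) := (continuous_snd.tendsto q).comp hpq
  -- Along an almost everywhere convergent subsequence, Fatou's lemma applies.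
  obtain ⟨ns, hns, hae⟩ := (tendstoInMeasure_of_tendsto_Lp h2).exists_seq_tendsto_ae
  have h1' := h1.comp hns.tendsto_atTop
  have hle : ∫⁻ y, F q.1 y (q.2 y) ∂ν
      ≤ ∫⁻ y, liminf (fun n => F (p (ns n)).1 y ((p (ns n)).2 y)) atTop ∂ν := by
    refine lintegral_mono_ae ?_
    filter_upwards [hae] with y hy
    have h3 := ((hF y).tendsto (q.1, q.2 y)).comp (h1'.prodMk_nhds hy)
    exact (Tendsto.liminf_eq h3).ge
  refine hle.trans ((lintegral_liminf_le' fun n => hFm _ _).trans ?_)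
  exact liminf_le_of_le (by isBoundedDefault) (fun b hb => by
    obtain ⟨n, hn⟩ := hb.exists
    exact hn.trans (hp (ns n)))

theorem LowerSemicontinuous.measurable_comp {α β : Type*} [MeasurableSpace α]
    [TopologicalSpace β] [TopologicalSpace.PseudoMetrizableSpace β] {G : β → ℝ≥0∞}
    (hG : LowerSemicontinuous G) {f : α → β} (hf : StronglyMeasurable f) :
    Measurable (fun a => G (f a)) := by
  borelize β
  exact hG.measurable.comp hf.measurable

end Measurability

/-! ### Measurability of the observation in time -/

namespace DampedSystem

variable {H V : Type*} [NormedAddCommGroup H] [InnerProductSpace ℝ H]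
  [NormedAddCommGroup V] [InnerProductSpace ℝ V] {J : ℕ} {N : Fin J → ℕ}
  {X : Fin J → Type*} [∀ j, MetricSpace (X j)] [∀ j, MeasurableSpace (X j)]
  {μ : ∀ j, Measure (X j)} (P : DampedSystem H V N X μ)

/-- The instantaneous observation of the `j`-th component. -/
noncomputable def density (j : Fin J) (t : ℝ) (u : V) : ℝ≥0∞ :=
  ∫⁻ y, ENNReal.ofReal
    (‖P.comp u j y‖ ^ 2 + P.α j t y ^ 2 * ‖P.g j (P.comp u j y)‖ ^ 2) ∂(μ j)

variable [∀ j, OpensMeasurableSpace (X j)] [∀ j, IsFiniteMeasure (μ j)]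

theorem lowerSemicontinuous_lintegral_observation (j : Fin J) :
    LowerSemicontinuous (fun p : ℝ × Lp (EuclideanSpace ℝ (Fin (N j))) 2 (μ j) =>
      ∫⁻ y, ENNReal.ofReal
        (‖p.2 y‖ ^ 2 + P.α j (max p.1 0) y ^ 2 * ‖P.g j (p.2 y)‖ ^ 2) ∂(μ j)) := by
  have hα : Continuous (fun p : ℝ × X j => P.α j (max p.1 0) p.2) :=
    (P.α_continuousOn j).comp_continuous (f := fun p : ℝ × X j => (max p.1 0, p.2))
      (by fun_prop) (fun p => ⟨mem_Ici.2 (le_max_right p.1 0), mem_univ _⟩)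
  have hg := P.g_continuous j
  refine lowerSemicontinuous_lintegral_comp (ν := μ j) (E := EuclideanSpace ℝ (Fin (N j)))
    (F := fun t y e => ENNReal.ofReal (‖e‖ ^ 2 + P.α j (max t 0) y ^ 2 * ‖P.g j e‖ ^ 2))
    (fun y => ?_) (fun t u => ?_)
  · have h1 : Continuous (fun t : ℝ => P.α j (max t 0) y) :=
      hα.comp (by fun_prop : Continuous (fun t : ℝ => (t, y)))
    exact ENNReal.continuous_ofReal.comp ((continuous_snd.norm.pow 2).add
      (((h1.comp continuous_fst).pow 2).mul ((hg.comp continuous_snd).norm.pow 2)))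
  · have h1 : Measurable (fun y => P.α j (max t 0) y) :=
      (hα.comp (by fun_prop : Continuous (fun y : X j => (t, y)))).measurable
    have h2 : AEStronglyMeasurable u (μ j) := Lp.aestronglyMeasurable u
    have h3 : AEStronglyMeasurable (fun y => P.g j (u y)) (μ j) := hg.comp_aestronglyMeasurable h2
    exact ((h2.norm.aemeasurable.pow_const 2).add
      ((h1.aemeasurable.pow_const 2).mul (h3.norm.aemeasurable.pow_const 2))).ennreal_ofReal

variable [CompleteSpace H] [CompleteSpace V]

theorem measurable_density {x : ℝ → V} (hx : ContinuousOn (fun t => P.ι (x t)) (Ici 0))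
    (j : Fin J) : Measurable (fun t => P.density j (max t 0) (x (max t 0))) := by
  have hxm : StronglyMeasurable (fun t => x (max t 0)) :=
    stronglyMeasurable_of_continuous_comp P.ι P.ι_injective
      (hx.comp_continuous (by fun_prop) (fun t => le_max_right t 0))
  have hc : Continuous (fun v : V =>
      ((P.IU v j : P.U j) : Lp (EuclideanSpace ℝ (Fin (N j))) 2 (μ j))) :=
    continuous_subtype_val.comp ((PiLp.continuous_apply 2 _ j).comp P.IU.continuous)
  have hu : StronglyMeasurable (fun t : ℝ =>
      ((P.IU (x (max t 0)) j : P.U j) : Lp (EuclideanSpace ℝ (Fin (N j))) 2 (μ j))) :=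
    hc.comp_stronglyMeasurable hxm
  have hm := (P.lowerSemicontinuous_lintegral_observation j).measurable_comp
    ((stronglyMeasurable_id (α := ℝ)).prodMk hu)
  exact hm

/-- Exchanging the sum with the lower integral needs measurability in time of each density, which is
the purpose of the regularization. -/
theorem observation_eq_lintegral {x : ℝ → V} (hx : ContinuousOn (fun t => P.ι (x t)) (Ici 0))
    {a b : ℝ} (ha : 0 ≤ a) :
    P.observation x a b = ∫⁻ t in Ioc a b, ∑ j, P.density j t (x t) := by
  rw [lintegral_finsetSum']
  · rfl
  · intro j _
    refine (P.measurable_density hx j).aemeasurable.congr ?_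
    filter_upwards [ae_restrict_mem measurableSet_Ioc] with t ht
    rw [max_eq_left (ha.trans ht.1.le)]

end DampedSystem

/-! ### Bounds by lower integrals -/

/-- The increment of a function is bounded by the integral of any bound of its derivative,
which may fail to exist on a countable set. -/
theorem ofReal_abs_sub_le_lintegral {φ : ℝ → ℝ} {Φ : ℝ → ℝ≥0∞} {a b : ℝ} (hab : a ≤ b)
    (hφ : ContinuousOn φ (Icc a b)) {Z : Set ℝ} (hZ : Z.Countable)
    (hd : ∀ t ∈ Ioo a b \ Z, ∃ d, HasDerivAt φ d t ∧ ENNReal.ofReal |d| ≤ Φ t) :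
    ENNReal.ofReal |φ b - φ a| ≤ ∫⁻ t in Ioc a b, Φ t := by
  -- When the bound is finite it makes the derivative integrable, so the fundamental theorem of
  -- calculus off a countable set applies.
  by_cases htop : ∫⁻ t in Ioc a b, Φ t = ∞
  · rw [htop]; exact le_top
  have hd' : ∀ t ∈ Ioo a b \ Z, HasDerivAt φ (deriv φ t) t ∧ ‖deriv φ t‖ₑ ≤ Φ t := by
    intro t ht
    obtain ⟨d, h1, h2⟩ := hd t ht
    rw [h1.deriv, Real.enorm_eq_ofReal_abs]
    exact ⟨h1, h2⟩
  have hle : ∫⁻ t in Ioc a b, ‖deriv φ t‖ₑ ≤ ∫⁻ t in Ioc a b, Φ t := by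
    refine lintegral_mono_ae ?_
    have h1 : ∀ᵐ t ∂volume.restrict (Ioc a b), t ∉ Z :=
      ae_restrict_of_ae (hZ.ae_notMem volume)
    have h2 : ∀ᵐ t ∂volume.restrict (Ioc a b), t ≠ b :=
      ae_restrict_of_ae (by simp [ae_iff])
    filter_upwards [h1, h2, ae_restrict_mem measurableSet_Ioc] with t h1 h2 h3
    exact (hd' t ⟨⟨h3.1, lt_of_le_of_ne h3.2 h2⟩, h1⟩).2
  have hint : IntervalIntegrable (deriv φ) volume a b := by
    rw [intervalIntegrable_iff_integrableOn_Ioc_of_le hab]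
    exact ⟨(measurable_deriv φ).aestronglyMeasurable,
      lt_of_le_of_lt hle (lt_top_iff_ne_top.2 htop)⟩
  have hftc := integral_eq_of_hasDerivAt_off_countable_of_le φ (deriv φ) hab hZ hφ
    (fun t ht => (hd' t ht).1) hint
  rw [← hftc, intervalIntegral.integral_of_le hab, ← Real.enorm_eq_ofReal_abs]
  exact (enorm_integral_le_lintegral_enorm _).trans hle

/-- An integral of a sum is bounded by the sum of the lower integrals of pointwise bounds. -/
theorem ofReal_abs_sum_integral_le {J : ℕ} {X : Fin J → Type*}
    [∀ j, MeasurableSpace (X j)] {μ : ∀ j, Measure (X j)} {f : ∀ j, X j → ℝ} {F : ∀ j, X j → ℝ≥0∞}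
    (h : ∀ j y, ENNReal.ofReal |f j y| ≤ F j y) :
    ENNReal.ofReal |∑ j, ∫ y, f j y ∂(μ j)| ≤ ∑ j, ∫⁻ y, F j y ∂(μ j) := by
  rw [← Real.enorm_eq_ofReal_abs]
  refine (enorm_sum_le _ _).trans (Finset.sum_le_sum fun j _ => ?_)
  refine (enorm_integral_le_lintegral_enorm _).trans (lintegral_mono fun y => ?_)
  rw [Real.enorm_eq_ofReal_abs]
  exact h j y

/-! ### Energy and duality estimates for solutions -/

namespace DampedSystem

variable {H V : Type*} [NormedAddCommGroup H] [InnerProductSpace ℝ H]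
  [NormedAddCommGroup V] [InnerProductSpace ℝ V] {J : ℕ} {N : Fin J → ℕ}
  {X : Fin J → Type*} [∀ j, MetricSpace (X j)] [∀ j, MeasurableSpace (X j)]
  {μ : ∀ j, Measure (X j)} (P : DampedSystem H V N X μ)

theorem memLp_comp (u : V) (j : Fin J) : MemLp (P.comp u j) 2 (μ j) := Lp.memLp _

theorem IUdual_apply (u v : V) :
    P.IUdual u v = ∑ j, ∫ y, ⟪P.comp u j y, P.comp v j y⟫ ∂(μ j) := by
  have : P.IUdual u v = ⟪P.IU u, P.IU v⟫ := rfl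
  rw [this, PiLp.inner_apply]
  rfl

theorem IUdual_comm (u v : V) : P.IUdual u v = P.IUdual v u :=
  real_inner_comm (P.IU v) (P.IU u)

theorem IUdual_self_nonneg (u : V) : 0 ≤ P.IUdual u u :=
  real_inner_self_nonneg (x := P.IU u)

theorem lintegral_norm_comp_sq (u : V) :
    ∑ j, ∫⁻ y, ENNReal.ofReal (‖P.comp u j y‖ ^ 2) ∂(μ j) = ENNReal.ofReal (P.IUdual u u) := by
  rw [IUdual_apply, ENNReal.ofReal_sum_of_nonneg]
  · refine Finset.sum_congr rfl fun j _ => ?_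
    simp only [real_inner_self_eq_norm_sq]
    rw [ofReal_integral_eq_lintegral_ofReal]
    · exact (P.memLp_comp u j).integrable_norm_pow (by norm_num)
    · exact Eventually.of_forall fun y => by positivity
  · intro j _
    exact integral_nonneg fun y => real_inner_self_nonneg

variable {P}

/-- Pointwise Young inequality `2 |α| |g| |u| ≤ |u|² + α² |g|²`. -/
theorem IsFeedback.ofReal_abs_two_mul_self_le {t : ℝ} {u : V} {b : StrongDual ℝ V}
    (hb : P.IsFeedback t u b) :
    ENNReal.ofReal |2 * b u| ≤ ∑ j, P.density j t u := by
  rw [(hb u).2, Finset.mul_sum]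
  simp_rw [← integral_const_mul]
  refine ofReal_abs_sum_integral_le fun j y => ENNReal.ofReal_le_ofReal ?_
  have h1 := abs_real_inner_le_norm (P.g j (P.comp u j y)) (P.comp u j y)
  rw [abs_mul, abs_mul, abs_two]
  have h2 := mul_le_mul_of_nonneg_left h1 (abs_nonneg (P.α j t y))
  rw [← sq_abs (P.α j t y)]
  nlinarith [sq_nonneg (‖P.comp u j y‖ - |P.α j t y| * ‖P.g j (P.comp u j y)‖)]

theorem IsFeedback.ofReal_abs_IUdual_sub_le {t : ℝ} {u : V} {b : StrongDual ℝ V}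
    (hb : P.IsFeedback t u b) (v : V) :
    ENNReal.ofReal |P.IUdual u v - b v|
      ≤ ∑ j, P.density j t u + ENNReal.ofReal (1 / 2 * P.IUdual v v) := by
  have e : P.IUdual u v - b v
      = ∑ j, ∫ y, (⟪P.comp u j y, P.comp v j y⟫
        - P.α j t y * ⟪P.g j (P.comp u j y), P.comp v j y⟫) ∂(μ j) := by
    rw [IUdual_apply, (hb v).2, ← Finset.sum_sub_distrib]
    refine Finset.sum_congr rfl fun j _ => ?_
    exact (integral_sub (L2.integrable_inner (𝕜 := ℝ) (P.IU u j).1 (P.IU v j).1)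
      ((hb v).1 j)).symm
  rw [e, ENNReal.ofReal_mul (by norm_num), ← lintegral_norm_comp_sq, Finset.mul_sum,
    ← Finset.sum_add_distrib]
  have e2 : ∀ j, P.density j t u
      + ENNReal.ofReal (1 / 2) * ∫⁻ y, ENNReal.ofReal (‖P.comp v j y‖ ^ 2) ∂(μ j)
      = ∫⁻ y, (ENNReal.ofReal
        (‖P.comp u j y‖ ^ 2 + P.α j t y ^ 2 * ‖P.g j (P.comp u j y)‖ ^ 2)
        + ENNReal.ofReal (1 / 2) * ENNReal.ofReal (‖P.comp v j y‖ ^ 2)) ∂(μ j) := by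
    intro j
    have hm : AEMeasurable (fun y => ENNReal.ofReal (‖P.comp v j y‖ ^ 2)) (μ j) :=
      ((P.memLp_comp v j).1.norm.aemeasurable.pow_const 2).ennreal_ofReal
    rw [lintegral_add_right' _ (hm.const_mul _), lintegral_const_mul'' _ hm]
    rfl
  simp_rw [e2]
  refine ofReal_abs_sum_integral_le fun j y => ?_
  rw [← ENNReal.ofReal_mul (by norm_num), ← ENNReal.ofReal_add (by positivity) (by positivity)]
  refine ENNReal.ofReal_le_ofReal ?_
  set p := P.comp u j y
  set q := P.comp v j y
  set w := P.g j p
  set a := P.α j t y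
  rw [show ⟪p, q⟫ - a * ⟪w, q⟫ = ⟪p - a • w, q⟫ by
    rw [inner_sub_left, real_inner_smul_left]]
  have h1 := abs_real_inner_le_norm (p - a • w) q
  have h2 : ‖p - a • w‖ ≤ ‖p‖ + |a| * ‖w‖ := by
    refine (norm_sub_le _ _).trans ?_
    rw [norm_smul, Real.norm_eq_abs]
  have h3 := mul_le_mul_of_nonneg_right h2 (norm_nonneg q)
  rw [← sq_abs a]
  -- With `s = ‖p‖ + |a| ‖w‖`: `s ‖q‖ ≤ ½ s² + ½ ‖q‖²` and `½ s² ≤ ‖p‖² + a² ‖w‖²`.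
  nlinarith [sq_nonneg (‖p‖ + |a| * ‖w‖ - ‖q‖), sq_nonneg (‖p‖ - |a| * ‖w‖)]

theorem A₁_antisymm (hA : ∀ u : V, P.A₁ u u = 0) (u v : V) : P.A₁ u v = -P.A₁ v u := by
  have h := hA (u + v)
  simp only [map_add, _root_.add_apply, hA] at h
  linarith

/-- The realizations of `-A₁ - I_U` and `A₁ - I_U` in `H` are formally adjoint. -/
theorem inner_eq_of_generates (hA : ∀ u : V, P.A₁ u u = 0) {S R : C0Semigroup H}
    (hS : Generates P.ι (-P.A₁ - P.IUdual) S) (hR : Generates P.ι (P.A₁ - P.IUdual) R)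
    (y y' z z' : H) (hy : S.GeneratorMaps y y') (hz : R.GeneratorMaps z z') :
    ⟪y', z⟫ = ⟪y, z'⟫ := by
  obtain ⟨u, rfl, hu⟩ := (hS y y').1 hy
  obtain ⟨v, rfl, hv⟩ := (hR z z').1 hz
  rw [real_inner_comm z', ← hu v, ← hv u]
  simp only [_root_.sub_apply, _root_.neg_apply]
  rw [A₁_antisymm hA u v, IUdual_comm]
  ring

/-- Since `⟨A₁ u, u⟩ = 0`, the derivative of `‖x‖²` is `-2 ⟨B(t) x, x⟩`. The two-sided bound is what
later controls `x(a)` by `x(b)`. -/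
theorem IsSolution.ofReal_abs_norm_sq_sub_le [CompleteSpace H] [CompleteSpace V]
    [∀ j, OpensMeasurableSpace (X j)] [∀ j, IsFiniteMeasure (μ j)]
    (hA : ∀ u : V, P.A₁ u u = 0) {x₀ : H} {x : ℝ → V} (hx : P.IsSolution x₀ x)
    {a b : ℝ} (ha : 0 ≤ a) (hab : a ≤ b) :
    ENNReal.ofReal |‖P.ι (x b)‖ ^ 2 - ‖P.ι (x a)‖ ^ 2| ≤ P.observation x a b := by
  obtain ⟨Z, hZ, x', -, hx'⟩ := hx.equation
  rw [P.observation_eq_lintegral hx.continuousOn ha]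
  refine ofReal_abs_sub_le_lintegral (φ := fun t => ‖P.ι (x t)‖ ^ 2) hab
    ((hx.continuousOn.mono fun t ht => ha.trans ht.1).norm.pow 2) hZ fun t ht => ?_
  have ht0 : 0 < t := ha.trans_lt ht.1.1
  obtain ⟨hd, c, hc, hp⟩ := hx' t ⟨ht0.le, ht.2⟩
  refine ⟨_, (hd.hasDerivAt (Ici_mem_nhds ht0)).norm_sq, ?_⟩
  have h1 := hp (x t)
  rw [_root_.add_apply, hA, zero_add, inner_neg_left] at h1
  rw [real_inner_comm, show 2 * ⟪x' t, P.ι (x t)⟫ = -(2 * c (x t)) by rw [h1]; ring, abs_neg]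
  exact hc.ofReal_abs_two_mul_self_le

/-- Differentiate `⟪x(t), R(b - t) z⟫`: the `A₁` terms cancel, and the dissipation of the backward
orbit pays for Young's inequality. -/
theorem IsSolution.ofReal_abs_inner_sub_le [CompleteSpace H] [CompleteSpace V]
    [∀ j, OpensMeasurableSpace (X j)] [∀ j, IsFiniteMeasure (μ j)]
    (hA : ∀ u : V, P.A₁ u u = 0) {R : C0Semigroup H}
    (hR : Generates P.ι (P.A₁ - P.IUdual) R) {x₀ : H} {x : ℝ → V} (hx : P.IsSolution x₀ x)
    {a b : ℝ} (ha : 0 ≤ a) (hab : a ≤ b) {z z' : H} (hz : R.GeneratorMaps z z') :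
    ENNReal.ofReal |⟪P.ι (x b), z⟫ - ⟪P.ι (x a), R.toFun (b - a) z⟫|
      ≤ P.observation x a b + ENNReal.ofReal (1 / 4 * ‖z‖ ^ 2) := by
  obtain ⟨Z, hZ, x', -, hx'⟩ := hx.equation
  let r : ℝ → H := fun t => R.toFun (max (b - t) 0) z
  -- For `t < b` this is `½ ⟪r, r'⟫`, the derivative of `¼ ‖r‖²`. It equals `½ ⟨I_U v, v⟩` for the
  -- representative `v ∈ V` of `r t`, but written in `H` it is visibly continuous.
  let k : ℝ → ℝ := fun t => 1 / 2 * ⟪r t, -R.toFun (max (b - t) 0) z'⟫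
  have hrc : Continuous r := (R.continuous_orbit z).comp (by fun_prop : Continuous (b - ·))
  have hkc : Continuous k := continuous_const.mul (hrc.inner
    ((R.continuous_orbit z').comp (by fun_prop : Continuous (b - ·))).neg)
  have hrd : ∀ t < b, HasDerivAt r (-R.toFun (max (b - t) 0) z') t := by
    intro t ht
    have := (hz.hasDerivAt (sub_pos.2 ht)).comp_const_sub b t
    rwa [max_eq_left (sub_nonneg.2 ht.le)]
  have hrv : ∀ t ≤ b, ∃ v, P.ι v = r t ∧
      BelongsToPivot P.ι ((P.A₁ - P.IUdual) v) (R.toFun (max (b - t) 0) z') := fun t ht =>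
    (hR _ _).1 (hz.apply (le_max_right _ _))
  have hkI : ∀ t v, P.ι v = r t →
      BelongsToPivot P.ι ((P.A₁ - P.IUdual) v) (R.toFun (max (b - t) 0) z') →
      k t = 1 / 2 * P.IUdual v v := by
    intro t v hv hp
    have := hp v
    rw [_root_.sub_apply, _root_.sub_apply, hA, hv] at this
    simp only [k]
    rw [inner_neg_right, real_inner_comm, ← this]
    ring
  have hk0 : ∀ t ≤ b, 0 ≤ k t := by
    intro t ht
    obtain ⟨v, hv, hp⟩ := hrv t ht
    rw [hkI t v hv hp]
    exact mul_nonneg (by norm_num) (P.IUdual_self_nonneg v)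
  have hrb : r b = z := by simp [r, R.map_zero]
  have hk : ∫⁻ t in Ioc a b, ENNReal.ofReal (k t) ≤ ENNReal.ofReal (1 / 4 * ‖z‖ ^ 2) := by
    have h1 : ∫ t in a..b, k t = 1 / 4 * ‖r b‖ ^ 2 - 1 / 4 * ‖r a‖ ^ 2 := by
      refine intervalIntegral.integral_eq_sub_of_hasDerivAt_of_le hab
        (f := fun t => 1 / 4 * ‖r t‖ ^ 2)
        (Continuous.continuousOn (by fun_prop)) (fun t ht => ?_)
        (hkc.intervalIntegrable _ _)
      have := (hrd t ht.2).norm_sq.const_mul (1 / 4)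
      rwa [show 1 / 4 * (2 * ⟪r t, -R.toFun (max (b - t) 0) z'⟫) = k t by
        simp only [k]; ring] at this
    rw [← ofReal_integral_eq_lintegral_ofReal, ← intervalIntegral.integral_of_le hab, h1, hrb]
    · exact ENNReal.ofReal_le_ofReal (by nlinarith [sq_nonneg ‖r a‖])
    · exact (hkc.intervalIntegrable a b).1
    · filter_upwards [ae_restrict_mem measurableSet_Ioc] with t ht using hk0 t ht.2
  rw [P.observation_eq_lintegral hx.continuousOn ha]
  refine le_trans ?_ (add_le_add_right hk _)
  rw [← lintegral_add_right _ (hkc.measurable.ennreal_ofReal)]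
  have hmain := ofReal_abs_sub_le_lintegral (φ := fun t => ⟪P.ι (x t), r t⟫)
    (Φ := fun t => ∑ j, P.density j t (x t) + ENNReal.ofReal (k t)) hab
    (ContinuousOn.inner (hx.continuousOn.mono fun t ht => ha.trans ht.1) hrc.continuousOn) hZ
    fun t ht => ?_
  · simpa only [hrb, r, max_eq_left (sub_nonneg.2 hab)] using hmain
  have ht0 : 0 < t := ha.trans_lt ht.1.1
  obtain ⟨hd, c, hc, hp⟩ := hx' t ⟨ht0.le, ht.2⟩
  refine ⟨_, (hd.hasDerivAt (Ici_mem_nhds ht0)).inner ℝ (hrd t ht.1.2), ?_⟩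
  obtain ⟨v, hv, hpv⟩ := hrv t ht.1.2.le
  have h1 := hp v
  have h2 := hpv (x t)
  simp only [_root_.add_apply, _root_.sub_apply, inner_neg_left]
    at h1 h2
  rw [← hv, inner_neg_right, real_inner_comm (R.toFun _ z'), ← h2,
    show ⟪x' t, P.ι v⟫ = -(P.A₁ (x t) v + c v) by rw [h1, neg_neg],
    show -(P.A₁ v (x t) - P.IUdual v (x t)) + -(P.A₁ (x t) v + c v) = P.IUdual (x t) v - c v by
      rw [A₁_antisymm hA (x t) v, P.IUdual_comm v]; ring,
    hkI t v hv hpv]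
  exact hc.ofReal_abs_IUdual_sub_le v

/-- Observability on `[a, b]`. -/
theorem IsSolution.ofReal_energy_le [CompleteSpace H] [CompleteSpace V]
    [∀ j, OpensMeasurableSpace (X j)] [∀ j, IsFiniteMeasure (μ j)]
    (hA : ∀ u : V, P.A₁ u u = 0) {R : C0Semigroup H}
    (hR : Generates P.ι (P.A₁ - P.IUdual) R) {x₀ : H} {x : ℝ → V} (hx : P.IsSolution x₀ x)
    {a b M : ℝ} (ha : 0 ≤ a) (hab : a ≤ b) (hM : ∀ z, ‖R.toFun (b - a) z‖ ≤ M * ‖z‖)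
    (hM2 : M ≤ 1 / 2) :
    ENNReal.ofReal (P.energy x b) ≤ ENNReal.ofReal 3 * P.observation x a b := by
  by_cases htop : P.observation x a b = ∞
  · rw [htop, ENNReal.mul_top (by simp)]; exact le_top
  obtain ⟨O, hO, hO0⟩ : ∃ O : ℝ, P.observation x a b = ENNReal.ofReal O ∧ 0 ≤ O :=
    ⟨_, (ENNReal.ofReal_toReal htop).symm, ENNReal.toReal_nonneg⟩
  have h1 := hx.ofReal_abs_norm_sq_sub_le hA ha hab
  rw [hO, ENNReal.ofReal_le_ofReal_iff hO0] at h1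
  -- The vector `x(b)` need not lie in the domain of the generator of `R`, so the estimate is first
  -- extended to all `z ∈ H` by density.
  have h2 : ∀ z, |⟪P.ι (x b), z⟫ - ⟪P.ι (x a), R.toFun (b - a) z⟫| ≤ O + 1 / 4 * ‖z‖ ^ 2 := by
    refine isClosed_property R.dense_domain.denseRange_val
      (isClosed_le (by fun_prop) (by fun_prop)) ?_
    rintro ⟨z, z', hz⟩
    have := hx.ofReal_abs_inner_sub_le hA hR ha hab hz
    rwa [hO, ← ENNReal.ofReal_add hO0 (by positivity),
      ENNReal.ofReal_le_ofReal_iff (by positivity)] at this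
  have h3 := (abs_le.1 (h2 (P.ι (x b)))).2
  rw [real_inner_self_eq_norm_sq] at h3
  have h4 : ⟪P.ι (x a), R.toFun (b - a) (P.ι (x b))⟫ ≤ ‖P.ι (x a)‖ * (1 / 2 * ‖P.ι (x b)‖) := by
    refine (real_inner_le_norm _ _).trans ?_
    gcongr
    exact (hM _).trans (by gcongr)
  have h5 := (abs_le.1 h1).1
  rw [hO, ← ENNReal.ofReal_mul (by norm_num)]
  refine ENNReal.ofReal_le_ofReal ?_
  simp only [energy]
  -- With `p = ‖x(a)‖`, `q = ‖x(b)‖`: `q² ≤ O + ¼ q² + ½ p q`, `½ p q ≤ ¼ (p² + q²)` and `p² ≤ q² +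
  -- O` give `q² ≤ 5 O`, so the energy is at most `(5/2) O`.
  nlinarith [sq_nonneg (‖P.ι (x a)‖ - ‖P.ι (x b)‖)]

end DampedSystem

/-! ### Choice of the constants and conclusion -/

theorem mainTheorem9 (C ω : ℝ) (hC : 0 < C) (hω : 0 < ω) :
    ∃ T₀ : ℝ, 0 < T₀ ∧ ∀ T : ℝ, T₀ ≤ T → ∃ D : ℝ, 1 < D ∧
      ∀ (H V : Type*) [NormedAddCommGroup H] [InnerProductSpace ℝ H] [CompleteSpace H]
        [NormedAddCommGroup V] [InnerProductSpace ℝ V] [CompleteSpace V]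
        (J : ℕ) (N : Fin J → ℕ) (X : Fin J → Type*)
        [∀ j, MetricSpace (X j)] [∀ j, MeasurableSpace (X j)]
        [∀ j, OpensMeasurableSpace (X j)]
        (μ : ∀ j, Measure (X j)) [∀ j, IsFiniteMeasure (μ j)]
        (P : DampedSystem H V N X μ),
        (∀ u : V, P.A₁ u u = 0) →
        (∃ S : C0Semigroup H, S.IsContractive ∧ Generates P.ι (P.A₁ - P.IUdual) S) →
        (∃ S : C0Semigroup H, S.IsContractive ∧ Generates P.ι (-P.A₁ - P.IUdual) S ∧
          ∀ t : ℝ, 0 ≤ t → ∀ x₀ : H, ‖S.toFun t x₀‖ ≤ C * Real.exp (-ω * t) * ‖x₀‖) →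
        ∀ (x₀ : H) (x : ℝ → V), P.IsSolution x₀ x →
          ENNReal.ofReal (P.energy x T) ≤ ENNReal.ofReal D * P.observation x 0 T ∧
          ∀ n : ℕ, ENNReal.ofReal (P.energy x (((n : ℝ) + 1) * T)) ≤
            ENNReal.ofReal D * P.observation x ((n : ℝ) * T) (((n : ℝ) + 1) * T) := by
  obtain ⟨T₀, hT₀, hexp⟩ : ∃ T₀ : ℝ, 0 < T₀ ∧ ∀ T, T₀ ≤ T → C * Real.exp (-ω * T) ≤ 1 / 2 := by
    have h1 : Tendsto (fun T : ℝ => C * Real.exp (-(ω * T))) atTop (𝓝 (C * 0)) :=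
      (Real.tendsto_exp_neg_atTop_nhds_zero.comp (tendsto_id.const_mul_atTop hω)).const_mul C
    rw [mul_zero] at h1
    obtain ⟨T₁, hT₁⟩ := eventually_atTop.1 (h1.eventually_le_const (by norm_num : (0 : ℝ) < 1 / 2))
    refine ⟨max T₁ 1, by positivity, fun T hT => ?_⟩
    have := hT₁ T ((le_max_left _ _).trans hT)
    rwa [neg_mul]
  -- The value `D = 3` serves every `T ≥ T₀`; `C` and `ω` enter only through `T₀`.
  refine ⟨T₀, hT₀, fun T hT => ⟨3, by norm_num, ?_⟩⟩
  rintro H V _ _ _ _ _ _ J N X _ _ _ μ _ P hA ⟨R, -, hR⟩ ⟨S, -, hS, hSdecay⟩ x₀ x hx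
  have hT0 : 0 < T := hT₀.trans_le hT
  have hRT : ∀ z, ‖R.toFun T z‖ ≤ C * Real.exp (-ω * T) * ‖z‖ :=
    C0Semigroup.norm_apply_le_of_generators (DampedSystem.inner_eq_of_generates hA hS hR) hT0
      (hSdecay T hT0.le)
  have key : ∀ a : ℝ, 0 ≤ a → ENNReal.ofReal (P.energy x (a + T)) ≤
      ENNReal.ofReal 3 * P.observation x a (a + T) := fun a ha =>
    hx.ofReal_energy_le hA hR ha (by linarith) (by simpa using hRT) (hexp T hT)
  refine ⟨by simpa using key 0 le_rfl, fun n => ?_⟩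
  have := key (n * T) (by positivity)
  rwa [show (n : ℝ) * T + T = (n + 1) * T by ring] at this
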